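/- Let $\mathbf{FHilb}$ be the dagger symmetric monoidal category of finite-dimensional complex Hilbert spaces and linear maps ($\otimes$ the tensor product, $\dagger$ the adjoint). Let $\mathbf{CPM}(\mathbf{FHilb})$ have the same objects; a morphism $A\to B$ is a completely positive map $A\otimes A^*\to B\otimes B^*$, i.e. one obtained from some linear $g:A\to B\otimes C$ by tracing $C$ out of $g\otimes g_*$, where $g_*=(g^\dagger)^*$. It is a dagger monoidal category with the tensor product and the adjoint inherited from $\mathbf{FHilb}$. Let $F:\mathbf{FHilb}\to\mathbf{CPM}(\mathbf{FHilb})$ be the strict monoidal functor that is the identity on objects (the object $F(A)$ standing for $A\otimes A^*$) and sends $f$ to $f\otimes f_*$. A projector-valued spectrum $(\Pi,\mu)$ on objects $S,p$ of $\mathbf{FHilb}$ consists of a special commutative $\dagger$-Frobenius algebra $\mu:p\otimes p\to p$ with unit $\eta:\mathbb C\to p$ and comultiplication $\delta=\mu^\dagger$, and a linear map $\Pi:S\otimes p\to S$ such that (suppressing associators and unitors) - $\Pi\circ(\Pi\otimes 1_p)=\Pi\circ(1_S\otimes\mu)$ ($p$-idempotent), - $\Pi^\dagger=(\Pi\otimes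 1_p)\circ(1_S\otimes(\delta\circ\eta))$ ($p$-self-adjoint), - $\Pi\circ(1_S\otimes\eta)=1_S$ ($p$-complete). Let $D:F(p)\to F(p)$ be the decoherence morphism in $\mathbf{CPM}(\mathbf{FHilb})$, i.e. $F(\delta)$ followed by discarding (tracing out) one of the two copies of $p$. The quantum measurement of $(\Pi,\mu)$ is the pair $$Q(\Pi)=(1_{F(S)}\otimes D)\circ F(\Pi^\dagger):F(S)\to F(S)\otimes F(p),\qquad Q(\mu)=(D\otimes D)\circ F(\mu^\dagger)\circ D:F(p)\to F(p)\otimes F(p).$$ A weak update structure $(\mathrm{put},\mathrm{get},\mathrm{mix},\mathrm{copy})$ on a system $S$ and a property $p$ in a monoidal category consists of morphisms $\mathrm{put}:S\otimes p\to S$, $\mathrm{get}:S\to S\otimes p$, $\mathrm{mix}:p\otimes p\to p$, $\mathrm{copy}:p\to p\otimes p$ such that (suppressing associators) - $\mathrm{put}\circ(\mathrm{put}\otimes 1_p)=\mathrm{put}\circ(1_S\otimes\mathrm{mix})$ (PutPut), - $(\mathrm{get}\otimes 1_p)\circ\mathrm{get}=(1_S\otimes\mathrm{copy})\circ\mathrm{get}$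 (GetGet), - $\mathrm{get}\circ\mathrm{put}=(\mathrm{put}\otimes 1_p)\circ(1_S\otimes\mathrm{copy})$ (PutGet), - $\mathrm{put}\circ(\mathrm{put}\otimes 1_p)\circ(1_S\otimes\mathrm{copy})=\mathrm{put}$ (repeat-update). Corollary. For every projector-valued spectrum $(\Pi,\mu)$ in $\mathbf{FHilb}$ with quantum measurement $(Q(\Pi),Q(\mu))$, the tuple $(Q(\Pi)^\dagger,\,Q(\Pi),\,Q(\mu)^\dagger,\,Q(\mu))$ is a weak update structure in $\mathbf{CPM}(\mathbf{FHilb})$ on the system $F(S)$ and the property $F(p)$. -/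

import Mathlib

open CategoryTheory MonoidalCategory

/-- A dagger on a category: an identity-on-objects, involutive, contravariant functor. -/
class DaggerCategory (C : Type*) [Category C] where
  dagger : ∀ {X Y : C}, (X ⟶ Y) → (Y ⟶ X)
  dagger_id : ∀ X : C, dagger (𝟙 X) = 𝟙 X
  dagger_comp : ∀ {X Y Z : C} (f : X ⟶ Y) (g : Y ⟶ Z), dagger (f ≫ g) = dagger g ≫ dagger f
  dagger_dagger : ∀ {X Y : C} (f : X ⟶ Y), dagger (dagger f) = f

/-- The dagger `f†` of a morphism. -/
postfix:max "†" => DaggerCategory.dagger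

/-- The axioms of a weak update structure `(put, get, mix, copy)` on a system `S` and a
property `p` in a monoidal category. -/
structure IsWeakUpdateStructure {C : Type*} [Category C] [MonoidalCategory C] {S p : C}
    (put : S ⊗ p ⟶ S) (get : S ⟶ S ⊗ p) (mix : p ⊗ p ⟶ p) (copy : p ⟶ p ⊗ p) : Prop where
  put_put : put ▷ p ≫ put = (α_ S p p).hom ≫ S ◁ mix ≫ put
  get_get : get ≫ get ▷ p = get ≫ S ◁ copy ≫ (α_ S p p).inv
  put_get : put ≫ get = S ◁ copy ≫ (α_ S p p).inv ≫ put ▷ p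
  /-- Updating twice with copies of a property is the same as updating once. -/
  repeat_update : S ◁ copy ≫ (α_ S p p).inv ≫ put ▷ p ≫ put = put

/-! ### The dagger symmetric monoidal category of finite-dimensional Hilbert spaces -/

/-- A finite-dimensional complex Hilbert space. -/
structure FHilb : Type 1 where
  carrier : Type
  [instNormed : NormedAddCommGroup carrier]
  [instInnerProduct : InnerProductSpace ℂ carrier]
  [instFinite : FiniteDimensional ℂ carrier]

namespace FHilb

attribute [instance] FHilb.instNormed FHilb.instInnerProduct FHilb.instFinite

instance : CoeSort FHilb Type := ⟨FHilb.carrier⟩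

/-- Morphisms of `FHilb` are the linear maps. -/
@[ext]
structure Hom (A B : FHilb) where
  lin : A →ₗ[ℂ] B

instance : Category FHilb where
  Hom := Hom
  id _ := ⟨LinearMap.id⟩
  comp f g := ⟨g.lin ∘ₗ f.lin⟩

@[ext] theorem hom_ext {A B : FHilb} {f g : A ⟶ B} (h : f.lin = g.lin) : f = g := Hom.ext h
@[simp] theorem id_lin (A : FHilb) : Hom.lin (𝟙 A) = LinearMap.id := rfl
@[simp] theorem comp_lin {A B C : FHilb} (f : A ⟶ B) (g : B ⟶ C) :
    (f ≫ g).lin = g.lin ∘ₗ f.lin := rfl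

noncomputable instance : DaggerCategory FHilb where
  dagger f := ⟨LinearMap.adjoint f.lin⟩
  dagger_id _ := by ext1; exact LinearMap.adjoint_id
  dagger_comp _ _ := by ext1; exact LinearMap.adjoint_comp _ _
  dagger_dagger _ := by ext1; exact LinearMap.adjoint_adjoint _

@[simp] theorem dagger_lin {A B : FHilb} (f : A ⟶ B) : f†.lin = LinearMap.adjoint f.lin := rfl

/-- A linear isomorphism as an isomorphism of `FHilb`. -/
def ofEquiv {A B : FHilb} (e : A ≃ₗ[ℂ] B) : A ≅ B where
  hom := ⟨e.toLinearMap⟩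
  inv := ⟨e.symm.toLinearMap⟩
  hom_inv_id := by ext1; simp
  inv_hom_id := by ext1; simp

@[simp] theorem ofEquiv_hom_lin {A B : FHilb} (e : A ≃ₗ[ℂ] B) :
    (ofEquiv e).hom.lin = e.toLinearMap := rfl
@[simp] theorem ofEquiv_inv_lin {A B : FHilb} (e : A ≃ₗ[ℂ] B) :
    (ofEquiv e).inv.lin = e.symm.toLinearMap := rfl

noncomputable instance : MonoidalCategoryStruct FHilb where
  tensorObj A B := ⟨TensorProduct ℂ A B⟩
  whiskerLeft _ _ _ f := ⟨TensorProduct.map LinearMap.id f.lin⟩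
  whiskerRight f _ := ⟨TensorProduct.map f.lin LinearMap.id⟩
  tensorHom f g := ⟨TensorProduct.map f.lin g.lin⟩
  tensorUnit := ⟨ℂ⟩
  associator A B C := ofEquiv (TensorProduct.assoc ℂ A B C)
  leftUnitor A := ofEquiv (TensorProduct.lid ℂ A)
  rightUnitor A := ofEquiv (TensorProduct.rid ℂ A)

/-- The pure tensor `a ⊗ b`. -/
noncomputable def tmul {A B : FHilb} (a : A) (b : B) : (A ⊗ B : FHilb) :=
  TensorProduct.tmul ℂ (M := A) (N := B) a b

infixr:70 " ⊗ᵥ " => tmul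

section tmul

variable {A B C : FHilb} (a a' : A) (b b' : B) (c : C)

theorem add_tmul : (a + a') ⊗ᵥ b = a ⊗ᵥ b + a' ⊗ᵥ b := TensorProduct.add_tmul a a' b
theorem tmul_add : a ⊗ᵥ (b + b') = a ⊗ᵥ b + a ⊗ᵥ b' := TensorProduct.tmul_add a b b'
@[simp] theorem zero_tmul : (0 : A) ⊗ᵥ b = 0 := TensorProduct.zero_tmul A b
@[simp] theorem tmul_zero : a ⊗ᵥ (0 : B) = 0 := TensorProduct.tmul_zero B a
@[simp] theorem smul_tmul (z : ℂ) : (z • a) ⊗ᵥ b = z • (a ⊗ᵥ b) := rfl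
@[simp] theorem tmul_smul (z : ℂ) : a ⊗ᵥ (z • b) = z • (a ⊗ᵥ b) := TensorProduct.tmul_smul z a b
@[simp] theorem inner_tmul : inner ℂ (a ⊗ᵥ b) (a' ⊗ᵥ b') = inner ℂ a a' * inner ℂ b b' :=
  TensorProduct.inner_tmul (𝕜 := ℂ) (E := A) (F := B) a a' b b'

theorem sum_tmul {ι : Type*} (s : Finset ι) (f : ι → A) :
    (∑ i ∈ s, f i) ⊗ᵥ b = ∑ i ∈ s, f i ⊗ᵥ b := TensorProduct.sum_tmul s f b
theorem tmul_sum {ι : Type*} (s : Finset ι) (f : ι → B) :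
    a ⊗ᵥ (∑ i ∈ s, f i) = ∑ i ∈ s, a ⊗ᵥ f i := TensorProduct.tmul_sum a s f

@[elab_as_elim]
theorem tensor_induction {P : (A ⊗ B : FHilb) → Prop} (x : (A ⊗ B : FHilb)) (zero : P 0)
    (tmul : ∀ a b, P (a ⊗ᵥ b)) (add : ∀ x y, P x → P y → P (x + y)) : P x :=
  TensorProduct.induction_on (R := ℂ) (M := A) (N := B) x zero tmul add

@[simp] theorem tensorHom_tmul {D : FHilb} (f : A ⟶ C) (g : B ⟶ D) :
    (f ⊗ₘ g).lin (a ⊗ᵥ b) = f.lin a ⊗ᵥ g.lin b := rfl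
@[simp] theorem whiskerLeft_tmul (g : B ⟶ C) : (A ◁ g).lin (a ⊗ᵥ b) = a ⊗ᵥ g.lin b := rfl
@[simp] theorem whiskerRight_tmul (f : A ⟶ C) : (f ▷ B).lin (a ⊗ᵥ b) = f.lin a ⊗ᵥ b := rfl
@[simp] theorem associator_hom_tmul :
    (α_ A B C).hom.lin ((a ⊗ᵥ b) ⊗ᵥ c) = a ⊗ᵥ (b ⊗ᵥ c) := rfl
@[simp] theorem associator_inv_tmul :
    (α_ A B C).inv.lin (a ⊗ᵥ (b ⊗ᵥ c)) = (a ⊗ᵥ b) ⊗ᵥ c := rfl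
@[simp] theorem leftUnitor_hom_tmul (z : ℂ) :
    (λ_ A).hom.lin (tmul (A := 𝟙_ FHilb) z a) = z • a := rfl
@[simp] theorem leftUnitor_inv_apply : (λ_ A).inv.lin a = tmul (A := 𝟙_ FHilb) (1 : ℂ) a := rfl
@[simp] theorem rightUnitor_hom_tmul (z : ℂ) :
    (ρ_ A).hom.lin (tmul (B := 𝟙_ FHilb) a z) = z • a := rfl
@[simp] theorem rightUnitor_inv_apply : (ρ_ A).inv.lin a = tmul (B := 𝟙_ FHilb) a (1 : ℂ) := rfl

/-- Morphisms out of a tensor product agree when they agree on pure tensors. -/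
theorem tensor_ext {f g : A ⊗ B ⟶ C} (h : ∀ a b, f.lin (a ⊗ᵥ b) = g.lin (a ⊗ᵥ b)) : f = g :=
  hom_ext (TensorProduct.ext' h)

theorem tensor_ext₃ {D : FHilb} {f g : (A ⊗ B) ⊗ C ⟶ D}
    (h : ∀ a b c, f.lin ((a ⊗ᵥ b) ⊗ᵥ c) = g.lin ((a ⊗ᵥ b) ⊗ᵥ c)) : f = g :=
  hom_ext (TensorProduct.ext_threefold h)

theorem tensor_ext₄ {D E : FHilb} {f g : ((A ⊗ B) ⊗ C) ⊗ D ⟶ E}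
    (h : ∀ a b c d, f.lin (((a ⊗ᵥ b) ⊗ᵥ c) ⊗ᵥ d) = g.lin (((a ⊗ᵥ b) ⊗ᵥ c) ⊗ᵥ d)) : f = g :=
  hom_ext (TensorProduct.ext_fourfold h)

theorem span_tmul {S : Set A} {T : Set B} (hS : Submodule.span ℂ S = ⊤)
    (hT : Submodule.span ℂ T = ⊤) : Submodule.span ℂ (Set.image2 tmul S T) = ⊤ := by
  have h := Submodule.map₂_span_span ℂ (TensorProduct.mk ℂ A B) S T
  rw [hS, hT, TensorProduct.map₂_mk_top_top_eq_top] at h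
  exact h.symm

/-- Morphisms that agree on a spanning set are equal. -/
theorem span_ext {S : Set A} (hS : Submodule.span ℂ S = ⊤) {f g : A ⟶ B}
    (h : ∀ a ∈ S, f.lin a = g.lin a) : f = g :=
  hom_ext (LinearMap.ext_on hS h)

/-- Adjointness may be checked on spanning sets. -/
theorem eq_dagger {S : Set A} {T : Set B} (hS : Submodule.span ℂ S = ⊤)
    (hT : Submodule.span ℂ T = ⊤) {f : A ⟶ B} {g : B ⟶ A}
    (h : ∀ a ∈ S, ∀ b ∈ T, inner ℂ (f.lin a) b = inner ℂ a (g.lin b)) : f = g† := by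
  refine hom_ext ((LinearMap.eq_adjoint_iff _ _).2 fun x y => ?_)
  have hx : x ∈ Submodule.span ℂ S := hS ▸ Submodule.mem_top
  have hy : y ∈ Submodule.span ℂ T := hT ▸ Submodule.mem_top
  induction hx using Submodule.span_induction with
  | zero => simp
  | add x x' _ _ hx hx' => simp [inner_add_left, hx, hx']
  | smul z x _ hx => simp [inner_smul_left, hx]
  | mem a ha =>
    induction hy using Submodule.span_induction with
    | zero => simp
    | add y y' _ _ hy hy' => simp [inner_add_right, hy, hy']
    | smul z y _ hy => simp [inner_smul_right, hy]
    | mem b hb => exact h a ha b hb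

end tmul

noncomputable instance : MonoidalCategory FHilb :=
  MonoidalCategory.ofTensorHom
    (id_tensorHom_id := fun _ _ => tensor_ext fun _ _ => rfl)
    (id_tensorHom := fun _ _ _ _ => rfl)
    (tensorHom_id := fun _ _ => rfl)
    (tensorHom_comp_tensorHom := fun _ _ _ _ => tensor_ext fun _ _ => rfl)
    (associator_naturality := fun _ _ _ => tensor_ext₃ fun _ _ _ => rfl)
    (leftUnitor_naturality := fun f => tensor_ext fun (a : ℂ) b => (f.lin.map_smul a b).symm)
    (rightUnitor_naturality := fun f => tensor_ext fun a (b : ℂ) => (f.lin.map_smul b a).symm)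
    (pentagon := fun _ _ _ _ => tensor_ext₄ fun _ _ _ _ => rfl)
    (triangle := fun _ _ => tensor_ext₃ fun a (c : ℂ) b => (TensorProduct.smul_tmul c a b).symm)

noncomputable instance : SymmetricCategory FHilb where
  braiding A B := ofEquiv (TensorProduct.comm ℂ A B)
  braiding_naturality_right _ _ _ _ := tensor_ext fun _ _ => rfl
  braiding_naturality_left _ _ := tensor_ext fun _ _ => rfl
  hexagon_forward _ _ _ := tensor_ext₃ fun _ _ _ => rfl
  hexagon_reverse A B C := by
    rw [← cancel_epi (α_ A B C).hom]
    exact tensor_ext₃ fun _ _ _ => rfl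
  symmetry _ _ := tensor_ext fun _ _ => rfl

@[simp] theorem braiding_hom_tmul {A B : FHilb} (a : A) (b : B) :
    (β_ A B).hom.lin (a ⊗ᵥ b) = b ⊗ᵥ a := rfl

/-- The dual Hilbert space `A*`: the functionals on `A`, with the inner product for which the
(conjugate-linear) Riesz map `a ↦ ⟪a, -⟫` is unitary. -/
noncomputable def dual (A : FHilb) : FHilb where
  carrier := StrongDual ℂ A
  instInnerProduct :=
    { inner := fun φ ψ =>
        inner ℂ ((InnerProductSpace.toDual ℂ A).symm ψ) ((InnerProductSpace.toDual ℂ A).symm φ)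
      norm_sq_eq_re_inner := fun φ => by
        rw [inner_self_eq_norm_sq, LinearIsometryEquiv.norm_map]
      conj_inner_symm := fun φ ψ => inner_conj_symm _ _
      add_left := fun φ ψ χ => by
        rw [map_add, inner_add_right]
      smul_left := fun φ ψ c => by
        rw [LinearIsometryEquiv.map_smulₛₗ, inner_smul_right] }
  instFinite := (inferInstance : FiniteDimensional ℂ (StrongDual ℂ A))

/-- The functional `⟪a, -⟫`. -/
noncomputable def bra {A : FHilb} (a : A) : dual A := InnerProductSpace.toDual ℂ A a

theorem bra_surjective {A : FHilb} (φ : dual A) : ∃ a, bra a = φ :=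
  (InnerProductSpace.toDual ℂ A).surjective φ

theorem bra_add {A : FHilb} (a b : A) : bra (a + b) = bra a + bra b :=
  map_add (InnerProductSpace.toDual ℂ A) a b

theorem bra_sum {A : FHilb} {ι : Type*} (s : Finset ι) (f : ι → A) :
    bra (∑ i ∈ s, f i) = ∑ i ∈ s, bra (f i) :=
  map_sum (InnerProductSpace.toDual ℂ A) f s

@[simp] theorem bra_zero {A : FHilb} : bra (0 : A) = 0 :=
  map_zero (InnerProductSpace.toDual ℂ A)

@[simp] theorem bra_smul {A : FHilb} (z : ℂ) (a : A) : bra (z • a) = star z • bra a :=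
  LinearIsometryEquiv.map_smulₛₗ (InnerProductSpace.toDual ℂ A) z a

@[simp] theorem inner_bra {A : FHilb} (a b : A) : inner ℂ (bra a) (bra b) = inner ℂ b a := by
  change inner ℂ ((InnerProductSpace.toDual ℂ A).symm (InnerProductSpace.toDual ℂ A b))
    ((InnerProductSpace.toDual ℂ A).symm (InnerProductSpace.toDual ℂ A a)) = _
  simp

/-- The map `f_* = (f†)^* : A* ⟶ B*`, i.e. precomposition with `f†`. -/
noncomputable def conj {A B : FHilb} (f : A ⟶ B) : dual A ⟶ dual B :=
  ⟨{ toFun := fun φ : A →L[ℂ] ℂ => φ ∘L LinearMap.toContinuousLinearMap (f†.lin)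
     map_add' := fun _ _ => rfl
     map_smul' := fun _ _ => rfl }⟩

@[simp] theorem conj_bra {A B : FHilb} (f : A ⟶ B) (a : A) :
    (conj f).lin (bra a) = bra (f.lin a) := by
  refine ContinuousLinearMap.ext fun b => ?_
  exact LinearMap.adjoint_inner_right f.lin a b

/-- Evaluation `A ⊗ A* ⟶ ℂ`, `a ⊗ φ ↦ φ a`. -/
noncomputable def eval (A : FHilb) : A ⊗ dual A ⟶ 𝟙_ FHilb :=
  ⟨TensorProduct.lift (LinearMap.flip
    { toFun := fun φ : A →L[ℂ] ℂ => φ.toLinearMap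
      map_add' := fun _ _ => rfl
      map_smul' := fun _ _ => rfl })⟩

@[simp] theorem eval_bra {A : FHilb} (a b : A) :
    (eval A).lin (a ⊗ᵥ bra b) = (inner ℂ b a : ℂ) := rfl

/-- The canonical isomorphism `A* ⊗ B* ≅ (A ⊗ B)*`, with `(φ ⊗ ψ) (a ⊗ b) = φ a * ψ b`. -/
noncomputable def dualTensor (A B : FHilb) : dual A ⊗ dual B ≅ dual (A ⊗ B) :=
  ofEquiv <|
    (TensorProduct.congr
      (LinearMap.toContinuousLinearMap (𝕜 := ℂ) (E := A) (F' := ℂ)).symm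
      (LinearMap.toContinuousLinearMap (𝕜 := ℂ) (E := B) (F' := ℂ)).symm).trans
    ((TensorProduct.dualDistribEquiv ℂ A B).trans
      (LinearMap.toContinuousLinearMap (𝕜 := ℂ) (E := TensorProduct ℂ A B) (F' := ℂ)))

@[simp] theorem dualTensor_hom_bra {A B : FHilb} (a : A) (b : B) :
    (dualTensor A B).hom.lin (bra a ⊗ᵥ bra b) = bra (a ⊗ᵥ b) := by
  refine ContinuousLinearMap.ext fun (x : (A ⊗ B : FHilb)) => ?_
  induction x using tensor_induction with
  | zero => exact (map_zero _).trans (map_zero _).symm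
  | add x y hx hy => exact (map_add _ _ _).trans ((congrArg₂ _ hx hy).trans (map_add _ _ _).symm)
  | tmul x y => exact (inner_tmul a x b y).symm

@[simp] theorem dualTensor_inv_bra {A B : FHilb} (a : A) (b : B) :
    (dualTensor A B).inv.lin (bra (a ⊗ᵥ b)) = bra a ⊗ᵥ bra b := by
  rw [← dualTensor_hom_bra]
  exact congrArg (fun f => f.lin (bra a ⊗ᵥ bra b)) (dualTensor A B).hom_inv_id

/-! ### Doubling -/

/-- The doubled object `A ⊗ A*`. -/
noncomputable abbrev dbl (A : FHilb) : FHilb := A ⊗ dual A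

/-- The doubled morphism `f ⊗ f_*`. -/
noncomputable def double {A B : FHilb} (f : A ⟶ B) : dbl A ⟶ dbl B := f ⊗ₘ conj f

@[simp] theorem double_tmul {A B : FHilb} (f : A ⟶ B) (a b : A) :
    (double f).lin (a ⊗ᵥ bra b) = f.lin a ⊗ᵥ bra (f.lin b) := by
  simp [double]

theorem dbl_ext {A B : FHilb} {f g : dbl A ⟶ B}
    (h : ∀ a b : A, f.lin (a ⊗ᵥ bra b) = g.lin (a ⊗ᵥ bra b)) : f = g :=
  tensor_ext fun a φ => by
    obtain ⟨b, rfl⟩ := bra_surjective φ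
    exact h a b

theorem span_bra {A : FHilb} {S : Set A} (hS : Submodule.span ℂ S = ⊤) :
    Submodule.span ℂ (bra '' S) = ⊤ := by
  have h := Submodule.map_span (InnerProductSpace.toDual ℂ A).toLinearEquiv.toLinearMap S
  rw [hS, Submodule.map_top, LinearMap.range_eq_top.2
    (InnerProductSpace.toDual ℂ A).surjective] at h
  exact h.symm

theorem span_dbl {A : FHilb} {S : Set A} (hS : Submodule.span ℂ S = ⊤) :
    Submodule.span ℂ (Set.image2 (fun a b => a ⊗ᵥ bra b) S S) = ⊤ := by
  rw [← span_tmul hS (span_bra hS), Set.image2_image_right]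

/-- The reordering `(A ⊗ A*) ⊗ (B ⊗ B*) ≅ (A ⊗ B) ⊗ (A ⊗ B)*`. -/
noncomputable def shuffle (A B : FHilb) : dbl A ⊗ dbl B ≅ dbl (A ⊗ B) :=
  ofEquiv (TensorProduct.tensorTensorTensorComm ℂ A (dual A) B (dual B)) ≪≫
    whiskerLeftIso (A ⊗ B : FHilb) (dualTensor A B)

@[simp] theorem shuffle_hom_bra {A B : FHilb} (a a' : A) (b b' : B) :
    (shuffle A B).hom.lin ((a ⊗ᵥ bra a') ⊗ᵥ (b ⊗ᵥ bra b')) = (a ⊗ᵥ b) ⊗ᵥ bra (a' ⊗ᵥ b') := by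
  rw [← dualTensor_hom_bra]
  rfl

@[simp] theorem shuffle_inv_bra {A B : FHilb} (a a' : A) (b b' : B) :
    (shuffle A B).inv.lin ((a ⊗ᵥ b) ⊗ᵥ bra (a' ⊗ᵥ b')) = (a ⊗ᵥ bra a') ⊗ᵥ (b ⊗ᵥ bra b') := by
  rw [← shuffle_hom_bra]
  exact congrArg (fun f => f.lin ((a ⊗ᵥ bra a') ⊗ᵥ (b ⊗ᵥ bra b'))) (shuffle A B).hom_inv_id

/-- The partial trace over `C`. -/
noncomputable def partialTrace (B C : FHilb) : dbl (B ⊗ C) ⟶ dbl B :=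
  (shuffle B C).inv ≫ dbl B ◁ eval C ≫ (ρ_ (dbl B)).hom

@[simp] theorem partialTrace_bra {B C : FHilb} (b b' : B) (c c' : C) :
    (partialTrace B C).lin ((b ⊗ᵥ c) ⊗ᵥ bra (b' ⊗ᵥ c')) =
      (inner ℂ c' c : ℂ) • (b ⊗ᵥ bra b') := by
  simp [partialTrace]

@[simp] theorem double_id (A : FHilb) : double (𝟙 A) = 𝟙 (dbl A) :=
  dbl_ext fun a b => by simp

@[simp] theorem double_comp {A B C : FHilb} (f : A ⟶ B) (g : B ⟶ C) :
    double (f ≫ g) = double f ≫ double g :=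
  dbl_ext fun a b => by simp

theorem shuffle_ext {A B C : FHilb} {f g : dbl A ⊗ dbl B ⟶ C}
    (h : ∀ a a' b b', f.lin ((a ⊗ᵥ bra a') ⊗ᵥ (b ⊗ᵥ bra b')) =
      g.lin ((a ⊗ᵥ bra a') ⊗ᵥ (b ⊗ᵥ bra b'))) : f = g := by
  refine span_ext (span_tmul (span_dbl Submodule.span_univ) (span_dbl Submodule.span_univ)) ?_
  rintro _ ⟨_, ⟨a, -, a', -, rfl⟩, _, ⟨b, -, b', -, rfl⟩, rfl⟩
  exact h a a' b b'

theorem shuffle_ext₃ {A B C D : FHilb} {f g : (dbl A ⊗ dbl B) ⊗ dbl C ⟶ D}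
    (h : ∀ a a' b b' c c', f.lin (((a ⊗ᵥ bra a') ⊗ᵥ (b ⊗ᵥ bra b')) ⊗ᵥ (c ⊗ᵥ bra c')) =
      g.lin (((a ⊗ᵥ bra a') ⊗ᵥ (b ⊗ᵥ bra b')) ⊗ᵥ (c ⊗ᵥ bra c'))) : f = g := by
  refine span_ext (span_tmul (span_tmul (span_dbl Submodule.span_univ)
    (span_dbl Submodule.span_univ)) (span_dbl Submodule.span_univ)) ?_
  rintro _ ⟨_, ⟨_, ⟨a, -, a', -, rfl⟩, _, ⟨b, -, b', -, rfl⟩, rfl⟩, _, ⟨c, -, c', -, rfl⟩, rfl⟩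
  exact h a a' b b' c c'

theorem double_tensorHom {A B C D : FHilb} (f : A ⟶ B) (g : C ⟶ D) :
    (shuffle A C).hom ≫ double (f ⊗ₘ g) = (double f ⊗ₘ double g) ≫ (shuffle B D).hom :=
  shuffle_ext fun a a' b b' => by simp

theorem shuffle_assoc (A B C : FHilb) :
    (shuffle A B).hom ▷ dbl C ≫ (shuffle (A ⊗ B) C).hom ≫ double (α_ A B C).hom =
      (α_ (dbl A) (dbl B) (dbl C)).hom ≫ dbl A ◁ (shuffle B C).hom ≫ (shuffle A (B ⊗ C)).hom :=
  shuffle_ext₃ fun a a' b b' c c' => by simp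

theorem shuffle_leftUnitor (A : FHilb) :
    (shuffle (𝟙_ FHilb) A).hom ≫ double (λ_ A).hom =
      eval (𝟙_ FHilb) ▷ dbl A ≫ (λ_ (dbl A)).hom :=
  shuffle_ext fun (z w : ℂ) a a' => by simp [smul_smul, mul_comm]

theorem shuffle_rightUnitor (A : FHilb) :
    (shuffle A (𝟙_ FHilb)).hom ≫ double (ρ_ A).hom =
      dbl A ◁ eval (𝟙_ FHilb) ≫ (ρ_ (dbl A)).hom :=
  shuffle_ext fun a a' (z w : ℂ) => by simp [smul_smul, mul_comm]

/-! ### Completely positive morphisms -/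

/-- A morphism `A ⊗ A* ⟶ B ⊗ B*` is completely positive if it arises from some
`g : A ⟶ B ⊗ C` by tracing the ancilla `C` out of `g ⊗ g_*`. -/
def IsCP {A B : FHilb} (f : dbl A ⟶ dbl B) : Prop :=
  ∃ (C : FHilb) (g : A ⟶ B ⊗ C), f = double g ≫ partialTrace B C

theorem isCP_double {A B : FHilb} (f : A ⟶ B) : IsCP (double f) := by
  refine ⟨𝟙_ FHilb, f ≫ (ρ_ B).inv, dbl_ext fun a b => ?_⟩
  simp only [double_comp, comp_lin, LinearMap.comp_apply, double_tmul, rightUnitor_inv_apply,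
    partialTrace_bra]
  change _ = (inner ℂ (1 : ℂ) (1 : ℂ) : ℂ) • _
  simp

theorem partialTrace_double {B C D : FHilb} (h : B ⟶ D) :
    partialTrace B C ≫ double h = double (h ▷ C) ≫ partialTrace D C := by
  refine span_ext (span_dbl (span_tmul Submodule.span_univ Submodule.span_univ)) ?_
  rintro _ ⟨_, ⟨b, -, c, -, rfl⟩, _, ⟨b', -, c', -, rfl⟩, rfl⟩
  simp

theorem partialTrace_partialTrace (E D C : FHilb) :
    partialTrace (E ⊗ D) C ≫ partialTrace E D =
      double (α_ E D C).hom ≫ partialTrace E (D ⊗ C) := by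
  refine span_ext (span_dbl (span_tmul
    (span_tmul Submodule.span_univ Submodule.span_univ) Submodule.span_univ)) ?_
  rintro _ ⟨_, ⟨_, ⟨e, -, d, -, rfl⟩, c, -, rfl⟩, _, ⟨_, ⟨e', -, d', -, rfl⟩, c', -, rfl⟩, rfl⟩
  simp [smul_smul, mul_comm]

theorem IsCP.comp {A B C : FHilb} {f : dbl A ⟶ dbl B} {g : dbl B ⟶ dbl C}
    (hf : IsCP f) (hg : IsCP g) : IsCP (f ≫ g) := by
  obtain ⟨D, k, rfl⟩ := hf
  obtain ⟨E, l, rfl⟩ := hg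
  refine ⟨E ⊗ D, k ≫ l ▷ D ≫ (α_ C E D).hom, ?_⟩
  simp only [double_comp, Category.assoc]
  rw [← partialTrace_partialTrace, ← Category.assoc (double (l ▷ D)), ← partialTrace_double]
  simp

/-- The tensor product of two maps between doubled objects. -/
noncomputable def cpTensor {A B C D : FHilb} (f : dbl A ⟶ dbl B) (g : dbl C ⟶ dbl D) :
    dbl (A ⊗ C) ⟶ dbl (B ⊗ D) :=
  (shuffle A C).inv ≫ (f ⊗ₘ g) ≫ (shuffle B D).hom

theorem cpTensor_double {A B C D : FHilb} (f : A ⟶ B) (g : C ⟶ D) :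
    cpTensor (double f) (double g) = double (f ⊗ₘ g) := by
  rw [cpTensor, ← double_tensorHom, Iso.inv_hom_id_assoc]

theorem cpTensor_id (A B : FHilb) : cpTensor (𝟙 (dbl A)) (𝟙 (dbl B)) = 𝟙 (dbl (A ⊗ B)) := by
  simp [cpTensor]

theorem cpTensor_comp {A B C A' B' C' : FHilb} (f : dbl A ⟶ dbl B) (g : dbl B ⟶ dbl C)
    (f' : dbl A' ⟶ dbl B') (g' : dbl B' ⟶ dbl C') :
    cpTensor (f ≫ g) (f' ≫ g') = cpTensor f f' ≫ cpTensor g g' := by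
  simp [cpTensor]

theorem cpTensor_partialTrace (B C B' C' : FHilb) :
    cpTensor (partialTrace B C) (partialTrace B' C') =
      double (tensorμ B C B' C') ≫ partialTrace (B ⊗ B') (C ⊗ C') := by
  refine span_ext (span_dbl (span_tmul (span_tmul Submodule.span_univ Submodule.span_univ)
    (span_tmul Submodule.span_univ Submodule.span_univ))) ?_
  rintro _ ⟨_, ⟨_, ⟨b, -, c, -, rfl⟩, _, ⟨d, -, e, -, rfl⟩, rfl⟩,
    _, ⟨_, ⟨b', -, c', -, rfl⟩, _, ⟨d', -, e', -, rfl⟩, rfl⟩, rfl⟩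
  simp [cpTensor, tensorμ, smul_smul, mul_comm]

theorem IsCP.tensor {A B C D : FHilb} {f : dbl A ⟶ dbl B} {g : dbl C ⟶ dbl D}
    (hf : IsCP f) (hg : IsCP g) : IsCP (cpTensor f g) := by
  obtain ⟨E, k, rfl⟩ := hf
  obtain ⟨E', l, rfl⟩ := hg
  refine ⟨E ⊗ E', (k ⊗ₘ l) ≫ tensorμ B E D E', ?_⟩
  rw [cpTensor_comp, cpTensor_double, cpTensor_partialTrace, double_comp, Category.assoc]

theorem cpTensor_assoc {A B C A' B' C' : FHilb} (f : dbl A ⟶ dbl A') (g : dbl B ⟶ dbl B')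
    (h : dbl C ⟶ dbl C') :
    cpTensor (cpTensor f g) h ≫ double (α_ A' B' C').hom =
      double (α_ A B C).hom ≫ cpTensor f (cpTensor g h) := by
  have e₁ := shuffle_assoc A B C
  have e₂ := shuffle_assoc A' B' C'
  rw [← cancel_epi (shuffle (A ⊗ B) C).hom, ← cancel_epi ((shuffle A B).hom ▷ dbl C)]
  have k₁ : (cpTensor f g ⊗ₘ h) = (shuffle A B).inv ▷ dbl C ≫ ((f ⊗ₘ g) ⊗ₘ h) ≫
      (shuffle A' B').hom ▷ dbl C' := by
    simp only [cpTensor, ← MonoidalCategory.tensorHom_id, tensorHom_comp_tensorHom,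
      Category.id_comp, Category.comp_id]
  have k₂ : (f ⊗ₘ cpTensor g h) = dbl A ◁ (shuffle B C).inv ≫ (f ⊗ₘ (g ⊗ₘ h)) ≫
      dbl A' ◁ (shuffle B' C').hom := by
    simp only [cpTensor, ← MonoidalCategory.id_tensorHom, tensorHom_comp_tensorHom,
      Category.id_comp, Category.comp_id]
  rw [show cpTensor (cpTensor f g) h = (shuffle (A ⊗ B) C).inv ≫ (cpTensor f g ⊗ₘ h) ≫
      (shuffle (A' ⊗ B') C').hom from rfl, show cpTensor f (cpTensor g h) =
      (shuffle A (B ⊗ C)).inv ≫ (f ⊗ₘ cpTensor g h) ≫ (shuffle A' (B' ⊗ C')).hom from rfl, k₁, k₂]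
  simp only [Category.assoc, Iso.hom_inv_id_assoc, hom_inv_whiskerRight_assoc]
  rw [reassoc_of% e₁, e₂, associator_naturality_assoc]
  simp only [Iso.hom_inv_id_assoc, whiskerLeft_hom_inv_assoc]

theorem cpTensor_leftUnitor {A B : FHilb} (f : dbl A ⟶ dbl B) :
    cpTensor (𝟙 (dbl (𝟙_ FHilb))) f ≫ double (λ_ B).hom = double (λ_ A).hom ≫ f := by
  rw [← cancel_epi (shuffle (𝟙_ FHilb) A).hom, ← Category.assoc _ _ f, shuffle_leftUnitor]
  simp only [cpTensor, Category.assoc, Iso.hom_inv_id_assoc]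
  rw [shuffle_leftUnitor, MonoidalCategory.id_tensorHom, whisker_exchange_assoc,
    leftUnitor_naturality]

theorem cpTensor_rightUnitor {A B : FHilb} (f : dbl A ⟶ dbl B) :
    cpTensor f (𝟙 (dbl (𝟙_ FHilb))) ≫ double (ρ_ B).hom = double (ρ_ A).hom ≫ f := by
  rw [← cancel_epi (shuffle A (𝟙_ FHilb)).hom, ← Category.assoc _ _ f, shuffle_rightUnitor]
  simp only [cpTensor, Category.assoc, Iso.hom_inv_id_assoc]
  rw [shuffle_rightUnitor, MonoidalCategory.tensorHom_id, ← whisker_exchange_assoc,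
    rightUnitor_naturality]

theorem dagger_double {A B : FHilb} (f : A ⟶ B) : (double f)† = double f† := by
  refine (eq_dagger (span_dbl Submodule.span_univ) (span_dbl Submodule.span_univ) ?_).symm
  rintro _ ⟨a, -, a', -, rfl⟩ _ ⟨b, -, b', -, rfl⟩
  simp [LinearMap.adjoint_inner_left, LinearMap.adjoint_inner_right]

theorem isCP_dagger_partialTrace (B C : FHilb) : IsCP (partialTrace B C)† := by
  let e := stdOrthonormalBasis ℂ C
  obtain ⟨g, hg⟩ : ∃ g : B ⟶ (B ⊗ C) ⊗ C, ∀ x : B, g.lin x = ∑ i, (x ⊗ᵥ e i) ⊗ᵥ e i := by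
    let s : (C ⊗ C : FHilb) := ∑ i, e i ⊗ᵥ e i
    let k : B ⟶ B ⊗ (C ⊗ C) := ⟨(TensorProduct.mk ℂ B (C ⊗ C : FHilb)).flip s⟩
    have hk : ∀ b, k.lin b = b ⊗ᵥ s := fun _ => rfl
    refine ⟨k ≫ (α_ B C C).inv, fun x => ?_⟩
    simp only [comp_lin, LinearMap.comp_apply, hk, s, tmul_sum, map_sum, associator_inv_tmul]
  refine ⟨C, g, (eq_dagger (span_dbl Submodule.span_univ)
    (span_dbl (span_tmul Submodule.span_univ Submodule.span_univ)) ?_).symm⟩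
  rintro _ ⟨b, -, b', -, rfl⟩ _ ⟨_, ⟨d, -, c, -, rfl⟩, _, ⟨d', -, c', -, rfl⟩, rfl⟩
  have he : ∀ i j, inner ℂ (e i) (e j) = if i = j then (1 : ℂ) else 0 :=
    orthonormal_iff_ite.1 e.orthonormal
  have hc : ∑ i, inner ℂ (e i) c * inner ℂ c' (e i) = inner ℂ c' c := by
    rw [← e.sum_inner_mul_inner c' c]
    exact Finset.sum_congr rfl fun i _ => mul_comm _ _
  simp only [comp_lin, LinearMap.comp_apply, double_tmul, hg, bra_sum, tmul_sum,
    sum_tmul, map_sum, partialTrace_bra, he, ite_smul, one_smul, zero_smul, Finset.sum_ite_eq,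
    Finset.mem_univ, if_true, sum_inner, inner_tmul, inner_bra, ← hc,
    Finset.sum_mul, inner_smul_right]
  refine Finset.sum_congr rfl fun i _ => ?_
  ring

theorem IsCP.dagger {A B : FHilb} {f : dbl A ⟶ dbl B} (hf : IsCP f) : IsCP f† := by
  obtain ⟨C, k, rfl⟩ := hf
  rw [DaggerCategory.dagger_comp, dagger_double]
  exact (isCP_dagger_partialTrace B C).comp (isCP_double _)

end FHilb

/-! ### The category `CPM(FHilb)` -/

/-- The objects of `CPM(FHilb)`: those of `FHilb`, where `A` stands for `A ⊗ A*`. -/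
structure CPM : Type 1 where
  base : FHilb

namespace CPM

open FHilb

/-- Morphisms `A ⟶ B` of `CPM(FHilb)` are the completely positive maps `A ⊗ A* ⟶ B ⊗ B*`. -/
@[ext]
structure Hom (A B : CPM) where
  map : dbl A.base ⟶ dbl B.base
  cp : IsCP map

noncomputable instance : Category CPM where
  Hom := Hom
  id A := ⟨𝟙 (dbl A.base), by rw [← double_id]; exact isCP_double _⟩
  comp f g := ⟨f.map ≫ g.map, f.cp.comp g.cp⟩

@[ext] theorem hom_ext {A B : CPM} {f g : A ⟶ B} (h : f.map = g.map) : f = g := Hom.ext h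
@[simp] theorem id_map (A : CPM) : Hom.map (𝟙 A) = 𝟙 (dbl A.base) := rfl
@[simp] theorem comp_map {A B C : CPM} (f : A ⟶ B) (g : B ⟶ C) :
    (f ≫ g).map = f.map ≫ g.map := rfl

noncomputable instance : DaggerCategory CPM where
  dagger f := ⟨f.map†, f.cp.dagger⟩
  dagger_id _ := hom_ext (DaggerCategory.dagger_id _)
  dagger_comp _ _ := hom_ext (DaggerCategory.dagger_comp _ _)
  dagger_dagger _ := hom_ext (DaggerCategory.dagger_dagger _)

@[simp] theorem dagger_map {A B : CPM} (f : A ⟶ B) : f†.map = f.map† := rfl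

/-- The functor `FHilb ⥤ CPM(FHilb)`, `f ↦ f ⊗ f_*`. -/
noncomputable def F : FHilb ⥤ CPM where
  obj A := ⟨A⟩
  map f := ⟨double f, isCP_double f⟩
  map_id _ := hom_ext (double_id _)
  map_comp _ _ := hom_ext (double_comp _ _)

@[simp] theorem F_map_map {A B : FHilb} (f : A ⟶ B) : (F.map f).map = double f := rfl

noncomputable instance : MonoidalCategoryStruct CPM where
  tensorObj A B := ⟨A.base ⊗ B.base⟩
  tensorHom f g := ⟨cpTensor f.map g.map, f.cp.tensor g.cp⟩
  whiskerLeft A _ _ f := ⟨cpTensor (𝟙 _) f.map, (𝟙 A : A ⟶ A).cp.tensor f.cp⟩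
  whiskerRight f B := ⟨cpTensor f.map (𝟙 _), f.cp.tensor (𝟙 B : B ⟶ B).cp⟩
  tensorUnit := ⟨𝟙_ FHilb⟩
  associator A B C := F.mapIso (α_ A.base B.base C.base)
  leftUnitor A := F.mapIso (λ_ A.base)
  rightUnitor A := F.mapIso (ρ_ A.base)

@[simp] theorem tensorHom_map {A B C D : CPM} (f : A ⟶ B) (g : C ⟶ D) :
    (f ⊗ₘ g).map = cpTensor f.map g.map := rfl
@[simp] theorem whiskerLeft_map (A : CPM) {B C : CPM} (f : B ⟶ C) :
    (A ◁ f).map = cpTensor (𝟙 _) f.map := rfl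
@[simp] theorem whiskerRight_map {A B : CPM} (f : A ⟶ B) (C : CPM) :
    (f ▷ C).map = cpTensor f.map (𝟙 _) := rfl

/-- `F` is strict monoidal. -/
theorem F_map_tensorHom {A B C D : FHilb} (f : A ⟶ B) (g : C ⟶ D) :
    F.map f ⊗ₘ F.map g = F.map (f ⊗ₘ g) := hom_ext (cpTensor_double f g)

noncomputable instance : MonoidalCategory CPM :=
  MonoidalCategory.ofTensorHom
    (id_tensorHom_id := fun A B => hom_ext (cpTensor_id A.base B.base))
    (id_tensorHom := fun _ _ _ _ => rfl)
    (tensorHom_id := fun _ _ => rfl)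
    (tensorHom_comp_tensorHom := fun _ _ _ _ => hom_ext (cpTensor_comp _ _ _ _).symm)
    (associator_naturality := fun f g h => hom_ext (cpTensor_assoc f.map g.map h.map))
    (leftUnitor_naturality := fun f => hom_ext (cpTensor_leftUnitor f.map))
    (rightUnitor_naturality := fun f => hom_ext (cpTensor_rightUnitor f.map))
    (pentagon := fun A B C D => by
      have h := congrArg F.map (pentagon A.base B.base C.base D.base)
      rw [← MonoidalCategory.id_tensorHom, ← MonoidalCategory.tensorHom_id] at h
      simp only [Functor.map_comp, ← F_map_tensorHom, F.map_id] at h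
      exact h)
    (triangle := fun A B => by
      have h := congrArg F.map (triangle A.base B.base)
      rw [← MonoidalCategory.id_tensorHom, ← MonoidalCategory.tensorHom_id] at h
      simp only [Functor.map_comp, ← F_map_tensorHom, F.map_id] at h
      exact h)

end CPM

/-! ### Projector-valued spectra and quantum measurements -/

/-- A special commutative `†`-Frobenius algebra on `p`; the comultiplication is `mul†`. -/
structure SpecialCommDaggerFrobenius {C : Type*} [Category C] [MonoidalCategory C]
    [BraidedCategory C] [DaggerCategory C] (p : C) where
  mul : p ⊗ p ⟶ p
  unit : 𝟙_ C ⟶ p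
  one_mul : unit ▷ p ≫ mul = (λ_ p).hom
  mul_one : p ◁ unit ≫ mul = (ρ_ p).hom
  mul_assoc : mul ▷ p ≫ mul = (α_ p p p).hom ≫ p ◁ mul ≫ mul
  mul_comm : (β_ p p).hom ≫ mul = mul
  frobenius_left : p ◁ mul† ≫ (α_ p p p).inv ≫ mul ▷ p = mul ≫ mul†
  frobenius_right : mul† ▷ p ≫ (α_ p p p).hom ≫ p ◁ mul = mul ≫ mul†
  special : mul† ≫ mul = 𝟙 p

/-- A projector-valued spectrum `(Π, μ)` in `FHilb`: a special commutative `†`-Frobenius algebra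
on `p` and a morphism `Π : S ⊗ p ⟶ S` that is `p`-idempotent, `p`-self-adjoint and
`p`-complete. -/
structure ProjectorValuedSpectrum (S p : FHilb) where
  frob : SpecialCommDaggerFrobenius p
  proj : S ⊗ p ⟶ S
  idempotent : proj ▷ p ≫ proj = (α_ S p p).hom ≫ S ◁ frob.mul ≫ proj
  selfAdjoint :
    proj† = (ρ_ S).inv ≫ S ◁ (frob.unit ≫ frob.mul†) ≫ (α_ S p p).inv ≫ proj ▷ p
  complete : (ρ_ S).inv ≫ S ◁ frob.unit ≫ proj = 𝟙 S

namespace CPM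

open FHilb

/-- Discarding a system: the trace `A ⊗ A* ⟶ ℂ`, as a morphism to the unit of `CPM(FHilb)`. -/
noncomputable def discard (A : CPM) : A ⟶ 𝟙_ CPM :=
  ⟨double (λ_ A.base).inv ≫ partialTrace (𝟙_ FHilb) A.base, A.base, (λ_ A.base).inv, rfl⟩

/-- The decoherence morphism of a special commutative `†`-Frobenius algebra: copy with the doubled
comultiplication, then discard one of the copies. -/
noncomputable def decoherence {p : FHilb} (m : SpecialCommDaggerFrobenius p) :
    F.obj p ⟶ F.obj p :=
  (F.map m.mul† : F.obj p ⟶ F.obj p ⊗ F.obj p) ≫ F.obj p ◁ discard (F.obj p) ≫ (ρ_ (F.obj p)).hom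

end CPM

namespace ProjectorValuedSpectrum

open CPM

variable {S p : FHilb} (M : ProjectorValuedSpectrum S p)

/-- The first component `Q(Π)` of the quantum measurement of `(Π, μ)`: the image `F(Π†)` of `Π`
with its property wire decohered. -/
noncomputable def measure : F.obj S ⟶ F.obj S ⊗ F.obj p :=
  (F.map M.proj† : F.obj S ⟶ F.obj S ⊗ F.obj p) ≫ F.obj S ◁ decoherence M.frob

/-- The second component `Q(μ)` of the quantum measurement of `(Π, μ)`: the image `F(μ†)` of `μ`
with all its property wires decohered. -/
noncomputable def measureCopy : F.obj p ⟶ F.obj p ⊗ F.obj p :=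
  decoherence M.frob ≫ (F.map M.frob.mul† : F.obj p ⟶ F.obj p ⊗ F.obj p) ≫
    (decoherence M.frob ⊗ₘ decoherence M.frob)

end ProjectorValuedSpectrum

open FHilb CPM

/-! A special commutative †-Frobenius algebra on `p` is an orthonormal basis `e i` of copyable
vectors, δ(e i) = e i ⊗ e i (`exists_copyable_basis`). The Frobenius law rules out nilpotents, so
characters separate the points of `p`. The Riesz vector of a character is copyable, and specialness
makes the nonzero copyable vectors orthonormal.

In such a basis Π becomes a family P_i = Π(- ⊗ e i) of self-adjoint operators with P_j P_i = δ_ij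
P_i. Decoherence kills the off-diagonal matrix units, so the measurement is ρ ↦ ∑ P_i ρ P_i ⊗
|e_i⟩⟨e_i|, and copying sends |e_i⟩⟨e_j| to δ_ij |e_i e_i⟩⟨e_i e_i|. With the adjoints of these two
maps (`measureMap_dagger`, `copyMap_dagger`), each of the four laws, evaluated on basis vectors of
the property, reduces to `op_op`. -/

/-- In an Artinian ring the Jacobson radical is the nilradical, here zero, so some maximal ideal
misses `a`. Its residue field is finite over the algebraically closed field ℂ, hence equal to ℂ. -/
theorem exists_algHom_ne_zero {A : Type*} [CommRing A] [Algebra ℂ A] [FiniteDimensional ℂ A]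
    [IsReduced A] {a : A} (ha : a ≠ 0) : ∃ χ : A →ₐ[ℂ] ℂ, χ a ≠ 0 := by
  have : IsArtinianRing A := IsArtinianRing.of_finite ℂ A
  have hn : a ∉ Ideal.jacobson (⊥ : Ideal A) := by
    rw [IsArtinianRing.jacobson_eq_radical, Ideal.mem_radical_iff]
    rintro ⟨n, hn⟩
    exact ha (eq_zero_of_pow_eq_zero (by simpa using hn))
  simp only [Ideal.jacobson, Ideal.mem_sInf, Set.mem_ofPred_eq, not_forall] at hn
  obtain ⟨I, ⟨-, hI⟩, haI⟩ := hn
  let := Ideal.Quotient.field I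
  have hb : Function.Bijective (algebraMap ℂ (A ⧸ I)) :=
    IsAlgClosed.algebraMap_bijective_of_isIntegral
  let e := (AlgEquiv.ofBijective (Algebra.ofId ℂ (A ⧸ I)) hb).symm
  refine ⟨e.toAlgHom.comp (Ideal.Quotient.mkₐ ℂ I), fun h => haI ?_⟩
  rw [← Ideal.Quotient.eq_zero_iff_mem]
  exact e.injective (h.trans (map_zero e).symm)

/-! ### Copyable bases of special commutative †-Frobenius algebras -/

namespace SpecialCommDaggerFrobenius

variable {p : FHilb} (m : SpecialCommDaggerFrobenius p)

/-- The product of two vectors. -/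
noncomputable def prod (a b : p) : p := m.mul.lin (a ⊗ᵥ b)

/-- The unit vector. -/
noncomputable def one : p := m.unit.lin (1 : ℂ)

theorem prod_comm (a b : p) : m.prod a b = m.prod b a :=
  congrArg (fun f => f.lin (b ⊗ᵥ a)) m.mul_comm

theorem prod_assoc (a b c : p) : m.prod (m.prod a b) c = m.prod a (m.prod b c) :=
  congrArg (fun f => f.lin ((a ⊗ᵥ b) ⊗ᵥ c)) m.mul_assoc

theorem one_prod (a : p) : m.prod m.one a = a :=
  (congrArg (fun f => f.lin (tmul (A := 𝟙_ FHilb) (1 : ℂ) a)) m.one_mul).trans (one_smul ℂ a)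

theorem prod_add (a b c : p) : m.prod a (b + c) = m.prod a b + m.prod a c := by
  simp [prod, tmul_add]

theorem prod_smul (z : ℂ) (a b : p) : m.prod a (z • b) = z • m.prod a b := by
  simp [prod]

/-- Multiplication by a vector. -/
noncomputable def mulLeft (a : p) : p →ₗ[ℂ] p where
  toFun := m.prod a
  map_add' := m.prod_add a
  map_smul' z b := m.prod_smul z a b

@[simp] theorem mulLeft_apply (a b : p) : m.mulLeft a b = m.prod a b := rfl

theorem inner_comul (x : p) (a b : p) :
    inner ℂ (m.mul†.lin x) (a ⊗ᵥ b) = inner ℂ x (m.prod a b) :=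
  LinearMap.adjoint_inner_left _ _ _

/-- The adjoint of a multiplication operator is linear over the algebra. -/
theorem adjoint_mulLeft_prod (b a x : p) :
    LinearMap.adjoint (m.mulLeft b) (m.prod a x) =
      m.prod (LinearMap.adjoint (m.mulLeft b) a) x := by
  refine ext_inner_left ℂ fun c => ?_
  rw [LinearMap.adjoint_inner_right, mulLeft_apply, ← inner_comul]
  have h := congrArg (fun f => f.lin (b ⊗ᵥ c)) m.frobenius_left
  simp only [comp_lin, LinearMap.comp_apply, whiskerLeft_tmul] at h
  change _ = m.mul†.lin (m.prod b c) at h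
  rw [← h, ← inner_comul]
  generalize m.mul†.lin c = y
  induction y using tensor_induction with
  | zero => simp
  | add y z hy hz => simp only [tmul_add, map_add, inner_add_left, hy, hz]
  | tmul y z =>
    rw [associator_inv_tmul, whiskerRight_tmul, inner_tmul, inner_tmul,
      LinearMap.adjoint_inner_right]
    rfl

/-- Write L for multiplication by `a` and u = L†a. Module linearity of L† gives ua = L†(aa) = 0, so
⟪u, u⟫ = ⟪au, a⟫ = 0. Then ⟪a, a⟫ = ⟪a·1, a⟫ = ⟪1, u⟫ = 0. -/
theorem eq_zero_of_prod_self {a : p} (h : m.prod a a = 0) : a = 0 := by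
  set u := LinearMap.adjoint (m.mulLeft a) a with hu
  have key (x : p) : LinearMap.adjoint (m.mulLeft a) (m.prod a x) = m.prod u x :=
    m.adjoint_mulLeft_prod a a x
  have hua : m.prod a u = 0 := by rw [prod_comm, ← key, h, map_zero]
  have hu0 : u = 0 := by
    rw [← inner_self_eq_zero (𝕜 := ℂ)]
    nth_rw 2 [hu]
    rw [LinearMap.adjoint_inner_right, mulLeft_apply, hua, inner_zero_left]
  have h1 : m.prod a m.one = a := by rw [prod_comm, one_prod]
  rw [← inner_self_eq_zero (𝕜 := ℂ)]
  nth_rw 1 [← h1]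
  rw [← mulLeft_apply, ← LinearMap.adjoint_inner_right, ← hu, hu0, inner_zero_right]

/-- The ring structure on `p` stays local to the proof, so the character is returned as a linear map
that is multiplicative for `prod`. -/
theorem exists_character_ne_zero {a : p} (ha : a ≠ 0) :
    ∃ χ : p →ₗ[ℂ] ℂ, (∀ x y, χ (m.prod x y) = χ x * χ y) ∧ χ a ≠ 0 := by
  let : CommRing p :=
    { (inferInstance : AddCommGroup p) with
      mul := m.prod
      one := m.one
      mul_assoc := m.prod_assoc
      mul_comm := m.prod_comm
      one_mul := m.one_prod
      mul_one := fun a => (m.prod_comm a m.one).trans (m.one_prod a)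
      left_distrib := m.prod_add
      right_distrib := fun a b c => by
        change m.prod (a + b) c = m.prod a c + m.prod b c
        simp [prod, add_tmul]
      zero_mul := fun a => by change m.prod 0 a = 0; simp [prod]
      mul_zero := fun a => by change m.prod a 0 = 0; simp [prod] }
  let : Algebra ℂ p := Algebra.ofModule
    (fun z a b => by change m.prod (z • a) b = z • m.prod a b; simp [prod])
    (fun z a b => m.prod_smul z a b)
  have : IsReduced p := (isReduced_iff_pow_one_lt 2 one_lt_two).2 fun x hx =>
    m.eq_zero_of_prod_self ((pow_two x).symm.trans hx)
  obtain ⟨χ, hχ⟩ := exists_algHom_ne_zero ha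
  exact ⟨χ.toLinearMap, fun x y => map_mul χ x y, hχ⟩

/-- Specialness turns copyability of `f` into f = ff; the product then moves across the inner
product and becomes δ(e) = e ⊗ e. -/
theorem inner_copyable {e f : p} (he : m.mul†.lin e = e ⊗ᵥ e) (hf : m.mul†.lin f = f ⊗ᵥ f) :
    inner ℂ e f = inner ℂ e f * inner ℂ e f := by
  have h : m.mul.lin (m.mul†.lin f) = f := congrArg (fun g => g.lin f) m.special
  nth_rw 1 [← h]
  rw [hf]
  change inner ℂ e (m.prod f f) = _
  rw [← inner_comul, he, inner_tmul]

theorem exists_copyable_basis : ∃ (ι : Type) (_ : Fintype ι) (e : OrthonormalBasis ι ℂ p),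
    ∀ i, m.mul†.lin (e i) = e i ⊗ᵥ e i := by
  -- The basis consists of all nonzero copyable vectors; by `inner_copyable` their inner products
  -- are 0 or 1.
  let ι := {e : p // m.mul†.lin e = e ⊗ᵥ e ∧ e ≠ 0}
  have h01 (i j : ι) : inner ℂ i.1 j.1 = 0 ∨ inner ℂ i.1 j.1 = (1 : ℂ) := by
    have h := m.inner_copyable i.2.1 j.2.1
    by_cases h0 : inner ℂ i.1 j.1 = (0 : ℂ)
    · exact .inl h0
    · exact .inr (mul_left_cancel₀ h0 (h.symm.trans (_root_.mul_one _).symm))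
  have hself (i : ι) : inner ℂ i.1 i.1 = (1 : ℂ) :=
    (h01 i i).resolve_left fun h => i.2.2 (inner_self_eq_zero.1 h)
  have horth : Orthonormal ℂ (Subtype.val : ι → p) := by
    classical
    rw [orthonormal_iff_ite]
    intro i j
    split_ifs with hij
    · rw [← hij, hself]
    -- Unit vectors with inner product 1 coincide: ‖i - j‖² = 1 - 1 - 1 + 1 = 0.
    · refine (h01 i j).resolve_right fun h => hij (Subtype.ext ?_)
      have h' : inner ℂ j.1 i.1 = (1 : ℂ) := by rw [← inner_conj_symm, h, map_one]
      rw [← sub_eq_zero, ← inner_self_eq_zero (𝕜 := ℂ), inner_sub_left, inner_sub_right,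
        inner_sub_right, h, h', hself, hself]
      ring
  have : Finite ι := horth.linearIndependent.finite
  let := Fintype.ofFinite ι
  have hspan : ⊤ ≤ Submodule.span ℂ (Set.range (Subtype.val : ι → p)) := by
    rw [top_le_iff, ← Submodule.orthogonal_eq_bot_iff, Submodule.eq_bot_iff]
    intro a ha
    by_contra h0
    obtain ⟨χ, hχ, hχa⟩ := m.exists_character_ne_zero h0
    -- The Riesz vector of χ is copyable because χ is multiplicative; a vector orthogonal to all
    -- copyable ones is therefore killed by χ.
    let e : p := (InnerProductSpace.toDual ℂ p).symm (LinearMap.toContinuousLinearMap χ)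
    have he (x : p) : inner ℂ e x = χ x := by simp [e]
    refine hχa ((he a).symm.trans ?_)
    refine ha e (Submodule.subset_span ⟨⟨e, ?_, fun h => hχa ?_⟩, rfl⟩)
    · refine ext_inner_right ℂ fun y => ?_
      induction y using tensor_induction with
      | zero => simp
      | add y z hy hz => simp only [inner_add_right, hy, hz]
      | tmul y z => rw [inner_comul, inner_tmul, he, he, he, hχ]
    · rw [← he, h, inner_zero_left]
  refine ⟨ι, inferInstance, OrthonormalBasis.mk horth hspan, fun i => ?_⟩
  rw [OrthonormalBasis.coe_mk]
  exact i.2.1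

end SpecialCommDaggerFrobenius

/-! ### Evaluating adjoints and tensor products of doubled maps -/

namespace FHilb

/-- Allows a value of an adjoint to be guessed and then tested on a spanning set, without a formula
for the whole adjoint. -/
theorem dagger_apply_eq {A B : FHilb} {T : Set A} (hT : Submodule.span ℂ T = ⊤) {f : A ⟶ B}
    {b : B} {c : A} (h : ∀ a ∈ T, inner ℂ (f.lin a) b = inner ℂ a c) : f†.lin b = c := by
  refine ext_inner_left ℂ fun x => ?_
  rw [dagger_lin, LinearMap.adjoint_inner_right]
  have hx : x ∈ Submodule.span ℂ T := hT ▸ Submodule.mem_top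
  induction hx using Submodule.span_induction with
  | zero => simp
  | add x x' _ _ hx hx' => simp [inner_add_left, hx, hx']
  | smul z x _ hx => simp [inner_smul_left, hx]
  | mem a ha => exact h a ha

theorem cpTensor_bra {A B C D : FHilb} (f : dbl A ⟶ dbl B) (g : dbl C ⟶ dbl D) (a a' : A)
    (c c' : C) : (cpTensor f g).lin ((a ⊗ᵥ c) ⊗ᵥ bra (a' ⊗ᵥ c')) =
      (shuffle B D).hom.lin (f.lin (a ⊗ᵥ bra a') ⊗ᵥ g.lin (c ⊗ᵥ bra c')) := by
  simp [cpTensor]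

theorem span_range_basis {p : FHilb} {ι : Type} [Fintype ι] (e : OrthonormalBasis ι ℂ p) :
    Submodule.span ℂ (Set.range e) = ⊤ := by
  rw [← e.coe_toBasis]
  exact e.toBasis.span_eq

end FHilb

/-! ### Product, unit and decoherence in a copyable basis -/

namespace SpecialCommDaggerFrobenius

variable {p : FHilb} (m : SpecialCommDaggerFrobenius p) {ι : Type} [Fintype ι] [DecidableEq ι]
  {e : OrthonormalBasis ι ℂ p} (he : ∀ i, m.mul†.lin (e i) = e i ⊗ᵥ e i)

/-- The underlying linear map of the decoherence morphism. -/
noncomputable def decoherenceMap : dbl p ⟶ dbl p := (decoherence m).map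

include he

theorem prod_basis (i j : ι) : m.prod (e i) (e j) = if i = j then e i else 0 := by
  refine InnerProductSpace.ext_inner_left_basis e.toBasis fun k => ?_
  rw [e.coe_toBasis, ← inner_comul, he, inner_tmul]
  have h := orthonormal_iff_ite.1 e.orthonormal
  rw [h, h]
  split_ifs <;> simp_all

/-- The coefficient at `e k` is found from 1 = ⟪e k, 1·e k⟫ = ⟪e k, 1⟫⟪e k, e k⟫. -/
theorem one_eq_sum : m.one = ∑ i, e i := by
  refine InnerProductSpace.ext_inner_left_basis e.toBasis fun k => ?_
  have h := orthonormal_iff_ite.1 e.orthonormal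
  have hk : inner ℂ (e k) (m.prod m.one (e k)) = (1 : ℂ) := by rw [one_prod, h, if_pos rfl]
  rw [← inner_comul, he, inner_tmul, h, if_pos rfl, _root_.mul_one] at hk
  rw [e.coe_toBasis, hk, inner_sum]
  simp [h]

/-- Tracing out the second copy contributes the factor ⟪e j, e i⟫. -/
theorem decoherenceMap_basis (i j : ι) :
    m.decoherenceMap.lin (e i ⊗ᵥ bra (e j)) = if i = j then e i ⊗ᵥ bra (e i) else 0 := by
  have h : m.decoherenceMap.lin (e i ⊗ᵥ bra (e j)) = (double (ρ_ p).hom).lin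
      ((cpTensor (𝟙 (dbl p)) (double (λ_ p).inv ≫ partialTrace (𝟙_ FHilb) p)).lin
        ((double m.mul†).lin (e i ⊗ᵥ bra (e j)))) := rfl
  have hj := orthonormal_iff_ite.1 e.orthonormal j i
  rw [h]
  simp only [comp_lin, LinearMap.comp_apply, double_tmul, he, cpTensor_bra, id_lin,
    LinearMap.id_apply, FHilb.leftUnitor_inv_apply, partialTrace_bra, hj, tmul_smul, map_smul,
    shuffle_hom_bra, rightUnitor_hom_tmul, one_smul]
  by_cases hij : i = j
  · subst hij
    simp
  · simp [hij, Ne.symm hij]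

end SpecialCommDaggerFrobenius

/-! ### The measurement, the copying of outcomes, and their adjoints -/

namespace ProjectorValuedSpectrum

variable {S p : FHilb} (M : ProjectorValuedSpectrum S p) {ι : Type} [Fintype ι] [DecidableEq ι]
  {e : OrthonormalBasis ι ℂ p} (he : ∀ i, M.frob.mul†.lin (e i) = e i ⊗ᵥ e i)

/-- The operator on the system selected by a vector of the property. -/
noncomputable def op (x : p) (s : S) : S := M.proj.lin (s ⊗ᵥ x)

/-- The underlying linear map of the measurement. -/
noncomputable def measureMap : dbl S ⟶ dbl (S ⊗ p) := M.measure.map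

/-- The underlying linear map of the copying of measurement outcomes. -/
noncomputable def copyMap : dbl p ⟶ dbl (p ⊗ p) := M.measureCopy.map

include he

theorem op_op (i j : ι) (s : S) :
    M.op (e j) (M.op (e i) s) = if i = j then M.op (e i) s else 0 := by
  have h : M.op (e j) (M.op (e i) s) = M.op (M.frob.prod (e i) (e j)) s :=
    congrArg (fun f => f.lin ((s ⊗ᵥ e i) ⊗ᵥ e j)) M.idempotent
  rw [h, M.frob.prod_basis he]
  split_ifs
  · rfl
  · simp [op]

/-- This is `p`-self-adjointness with δ(1) = ∑ e i ⊗ e i. -/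
theorem dagger_proj_lin (s : S) : M.proj†.lin s = ∑ i, M.op (e i) s ⊗ᵥ e i := by
  have h : M.proj†.lin s = (M.proj ▷ p).lin ((α_ S p p).inv.lin
      (s ⊗ᵥ M.frob.mul†.lin M.frob.one)) := congrArg (fun f => f.lin s) M.selfAdjoint
  rw [h, M.frob.one_eq_sum he]
  simp only [map_sum, he, tmul_sum, associator_inv_tmul, whiskerRight_tmul]
  rfl

/-- Pairing `dagger_proj_lin` with s ⊗ e i selects the i-th summand. -/
theorem inner_op (i : ι) (s t : S) : inner ℂ (M.op (e i) s) t = inner ℂ s (M.op (e i) t) := by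
  have h : inner ℂ (M.op (e i) s) t = inner ℂ (s ⊗ᵥ e i) (M.proj†.lin t) :=
    (LinearMap.adjoint_inner_right _ _ _).symm
  rw [h, M.dagger_proj_lin he]
  simp [orthonormal_iff_ite.1 e.orthonormal]

theorem measureMap_bra (s s' : S) : M.measureMap.lin (s ⊗ᵥ bra s') =
    ∑ i, (M.op (e i) s ⊗ᵥ e i) ⊗ᵥ bra (M.op (e i) s' ⊗ᵥ e i) := by
  have h : M.measureMap.lin (s ⊗ᵥ bra s') =
      (cpTensor (𝟙 (dbl S)) M.frob.decoherenceMap).lin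
        ((double M.proj†).lin (s ⊗ᵥ bra s')) := rfl
  rw [h, double_tmul, M.dagger_proj_lin he,
    M.dagger_proj_lin he]
  simp only [bra_sum, tmul_sum, sum_tmul, map_sum, cpTensor_bra, id_lin, LinearMap.id_apply]
  refine Finset.sum_congr rfl fun i _ => ?_
  -- Doubling Π† gives a sum over pairs of outcomes; decoherence keeps the diagonal.
  rw [Finset.sum_eq_single i]
  · rw [M.frob.decoherenceMap_basis he]
    rw [if_pos rfl, shuffle_hom_bra]
  · intro j _ hj
    rw [M.frob.decoherenceMap_basis he]
    simp [hj]
  · simp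

theorem measureMap_dagger (s s' : S) (i j : ι) :
    M.measureMap†.lin ((s ⊗ᵥ e i) ⊗ᵥ bra (s' ⊗ᵥ e j)) =
      if i = j then M.op (e i) s ⊗ᵥ bra (M.op (e i) s') else 0 := by
  refine dagger_apply_eq (span_dbl Submodule.span_univ) ?_
  rintro _ ⟨t, -, t', -, rfl⟩
  rw [M.measureMap_bra he, sum_inner]
  simp only [inner_tmul, inner_bra, orthonormal_iff_ite.1 e.orthonormal, mul_ite, mul_one,
    mul_zero, ite_mul, zero_mul]
  split_ifs with h
  · subst h
    simp [M.inner_op he]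
  · simp [Ne.symm h]

theorem copyMap_basis (i j : ι) : M.copyMap.lin (e i ⊗ᵥ bra (e j)) =
    if i = j then (e i ⊗ᵥ e i) ⊗ᵥ bra (e i ⊗ᵥ e i) else 0 := by
  have h : M.copyMap.lin (e i ⊗ᵥ bra (e j)) =
      (cpTensor M.frob.decoherenceMap M.frob.decoherenceMap).lin
        ((double M.frob.mul†).lin (M.frob.decoherenceMap.lin (e i ⊗ᵥ bra (e j)))) := rfl
  rw [h]
  rw [M.frob.decoherenceMap_basis he]
  split_ifs
  · rw [double_tmul, he]
    rw [cpTensor_bra, M.frob.decoherenceMap_basis he]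
    rw [if_pos rfl]
    exact shuffle_hom_bra _ _ _ _
  · simp

theorem copyMap_dagger (i j k l : ι) :
    M.copyMap†.lin ((e i ⊗ᵥ e j) ⊗ᵥ bra (e k ⊗ᵥ e l)) =
      if i = j ∧ i = k ∧ i = l then e i ⊗ᵥ bra (e i) else 0 := by
  -- Matrix units suffice as test vectors, and there `copyMap_basis` applies.
  refine dagger_apply_eq (span_dbl (span_range_basis e)) ?_
  rintro _ ⟨_, ⟨a, rfl⟩, _, ⟨b, rfl⟩, rfl⟩
  rw [M.copyMap_basis he]
  have h := orthonormal_iff_ite.1 e.orthonormal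
  by_cases hab : a = b
  · subst hab
    rw [if_pos rfl]
    by_cases hi : i = j ∧ i = k ∧ i = l
    · obtain ⟨rfl, rfl, rfl⟩ := hi
      simp [h]
      grind
    · rw [if_neg hi, inner_zero_right]
      simp [h]
      grind
  · rw [if_neg hab, inner_zero_left]
    split_ifs
    · simp only [inner_tmul, inner_bra, h]
      grind
    · simp

end ProjectorValuedSpectrum

/-! ### The four update laws -/

theorem mainTheorem6 {S p : FHilb} (M : ProjectorValuedSpectrum S p) :
    IsWeakUpdateStructure M.measure† M.measure M.measureCopy† M.measureCopy := by
  classical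
  obtain ⟨ι, _, e, he⟩ := M.frob.exists_copyable_basis
  -- System vectors stay arbitrary; only property vectors are restricted to the basis.
  have hSp := span_dbl (span_tmul (Submodule.span_univ (R := ℂ) (M := S)) (span_range_basis e))
  refine ⟨hom_ext ?_, hom_ext ?_, hom_ext ?_, hom_ext ?_⟩
  -- PutPut: both sides vanish unless i = j = k = l. On the left, the two updates force i = k and j
  -- = l, and P_j P_i = 0 handles i ≠ j.
  · change cpTensor M.measureMap† (𝟙 (dbl p)) ≫ M.measureMap† =
      double (α_ S p p).hom ≫ cpTensor (𝟙 (dbl S)) M.copyMap† ≫ M.measureMap†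
    refine span_ext (span_dbl (span_tmul (span_tmul Submodule.span_univ (span_range_basis e))
      (span_range_basis e))) ?_
    rintro _ ⟨_, ⟨_, ⟨s, -, _, ⟨i, rfl⟩, rfl⟩, _, ⟨j, rfl⟩, rfl⟩,
      _, ⟨_, ⟨s', -, _, ⟨k, rfl⟩, rfl⟩, _, ⟨l, rfl⟩, rfl⟩, rfl⟩
    simp only [comp_lin, LinearMap.comp_apply, double_tmul, associator_hom_tmul, cpTensor_bra,
      id_lin, LinearMap.id_apply, M.measureMap_dagger he, M.copyMap_dagger he]
    split_ifs with hik h <;>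
      simp only [zero_tmul, tmul_zero, map_zero, shuffle_hom_bra, M.measureMap_dagger he,
        M.op_op he]
    all_goals grind [zero_tmul]
  -- GetGet: in the double sum over outcomes, the second must repeat the first.
  · change M.measureMap ≫ cpTensor M.measureMap (𝟙 (dbl p)) =
      M.measureMap ≫ cpTensor (𝟙 (dbl S)) M.copyMap ≫ double (α_ S p p).inv
    refine dbl_ext fun s s' => ?_
    simp only [comp_lin, LinearMap.comp_apply, M.measureMap_bra he, map_sum, cpTensor_bra,
      id_lin, LinearMap.id_apply, M.copyMap_basis he, if_true, shuffle_hom_bra, double_tmul,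
      associator_inv_tmul, sum_tmul, M.op_op he]
    refine Finset.sum_congr rfl fun i _ => ?_
    rw [Finset.sum_eq_single i]
    · simp
    · intro j _ hj
      simp [Ne.symm hj]
    · simp
  -- PutGet: measuring after an update with outcome i leaves only the i-th summand, since P_k P_i =
  -- 0 for k ≠ i.
  · change M.measureMap† ≫ M.measureMap =
      cpTensor (𝟙 (dbl S)) M.copyMap ≫ double (α_ S p p).inv ≫
        cpTensor M.measureMap† (𝟙 (dbl p))
    refine span_ext hSp ?_
    rintro _ ⟨_, ⟨s, -, _, ⟨i, rfl⟩, rfl⟩, _, ⟨s', -, _, ⟨j, rfl⟩, rfl⟩, rfl⟩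
    simp only [comp_lin, LinearMap.comp_apply, cpTensor_bra, id_lin, LinearMap.id_apply,
      M.measureMap_dagger he, M.copyMap_basis he]
    split_ifs with hij
    · simp only [shuffle_hom_bra, double_tmul, associator_inv_tmul, cpTensor_bra,
        M.measureMap_dagger he, if_true, id_lin, LinearMap.id_apply, M.measureMap_bra he,
        M.op_op he]
      rw [Finset.sum_eq_single i]
      · simp
      · intro j _ hj
        simp [Ne.symm hj]
      · simp
    · simp
  -- Repeat-update: this is P_i P_i = P_i.
  · change cpTensor (𝟙 (dbl S)) M.copyMap ≫ double (α_ S p p).inv ≫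
        cpTensor M.measureMap† (𝟙 (dbl p)) ≫ M.measureMap† = M.measureMap†
    refine span_ext hSp ?_
    rintro _ ⟨_, ⟨s, -, _, ⟨i, rfl⟩, rfl⟩, _, ⟨s', -, _, ⟨j, rfl⟩, rfl⟩, rfl⟩
    simp only [comp_lin, LinearMap.comp_apply, cpTensor_bra, id_lin, LinearMap.id_apply,
      M.measureMap_dagger he, M.copyMap_basis he]
    split_ifs with hij
    · simp only [shuffle_hom_bra, double_tmul, associator_inv_tmul, cpTensor_bra,
        M.measureMap_dagger he, if_true, id_lin, LinearMap.id_apply, M.op_op he]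
    · simp
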